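/- Let $\mathcal H^R,\mathcal H^A,\mathcal H^B$ be finite-dimensional complex Hilbert spaces with fixed orthonormal bases, $d_A=\dim\mathcal H^A$, and write $L(A)$ for the operators on $\mathcal H^A$, etc. Let $\Psi:L(A)\to L(B)$ be a quantum channel (a completely positive, trace-preserving linear map). A tester (process-channel measurement) with finite outcome set is a pair $\mathcal T=(\rho^{RA},M)$ of a density operator $\rho^{RA}$ on $\mathcal H^R\otimes\mathcal H^A$ and a POVM $M=\{M_x\}_{x=1}^m$ on $\mathcal H^R\otimes\mathcal H^B$. Measuring $\Psi$ with $\mathcal T$ gives the probabilities $p_x=\mathrm{Tr}[M_x\,(\mathbb 1^R\otimes\Psi)(\rho^{RA})]$. Let $\phi_+=\sum_{i,j}|ii\rangle\langle jj|$ be the unnormalized maximally entangled operator on two copies of $\mathcal H^A$, let $\Upsilon_\rho:L(A)\to L(R)$ be the linear map with $(\Upsilon_\rho\otimes\mathbb 1^A)(\phi_+)=\rho^{RA}$, and let $\Upsilon_\rho^*$ be its dual for the Hilbert–Schmidt inner product. The process effects of $\mathcal T$ are $E_x=(\Upsilon_\rho^*\otimes\mathbb 1^B)(M_x)$, $1\le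 x\le m$, and the completed process effects are $\tilde E_x=E_x$ for $x\le m$ and $\tilde E_{m+1}=\mathbb 1^{AB}-(\rho^A)^{\mathrm T}\otimes\mathbb 1^B$, where $\rho^A=\mathrm{Tr}_R[\rho^{RA}]$ and $\mathrm T$ is the transpose. For a probability vector $\mathbf r$ and an order $\alpha\in(0,\infty]$ let $\mathrm H_\alpha(\mathbf r)=\frac{1}{1-\alpha}\log\sum_x r_x^\alpha$ be the Rényi entropy, with $\mathrm H_1(\mathbf r)=-\sum_x r_x\log r_x$ and $\mathrm H_\infty(\mathbf r)=-\log\max_x r_x$. **Theorem.** Let $\mathcal T_1=(\rho^{RA},M)$ and $\mathcal T_2=(\sigma^{RA},N)$ be two testers with $m$ and $n$ outcomes, with completed process effects $\{\tilde E_x\}_{x=1}^{m+1}$ and $\{\tilde F_y\}_{y=1}^{n+1}$, and let $\mathbf p$ and $\mathbf q$ be the probability vectors obtained by measuring $\Psi$ with $\mathcal T_1$ and $\mathcal T_2$. Let $$c(\mathcal T_1,\mathcal T_2)=\max_{x,y}\big\|\tilde E_x^{1/2}\tilde F_y^{1/2}\big\|$$ (operator norm, $1\le x\le m+1$, $1\le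 y\le n+1$). Then for all $\alpha,\beta\in(0,\infty]$ with $1/\alpha+1/\beta=2$, $$\mathrm H_\alpha\Big(\tfrac1{d_A}\mathbf p\oplus\tfrac{d_A-1}{d_A}\Big)+\mathrm H_\beta\Big(\tfrac1{d_A}\mathbf q\oplus\tfrac{d_A-1}{d_A}\Big)\ \ge\ -2\log c(\mathcal T_1,\mathcal T_2).$$ -/

import Mathlib

open scoped ENNReal Kronecker ComplexOrder

set_option linter.unusedSectionVars false

noncomputable section

namespace ProcessMU

section Basic

variable {n R A B X Y ι : Type*} [Fintype n] [DecidableEq n] [Fintype R] [DecidableEq R]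
  [Fintype A] [DecidableEq A] [Fintype B] [DecidableEq B] [Fintype X] [Fintype Y] [Fintype ι]

/-- Density operators: positive semidefinite with unit trace. -/
structure IsState (ρ : Matrix n n ℂ) : Prop where
  posSemidef : ρ.PosSemidef
  trace_eq_one : ρ.trace = 1

/-- Positive-operator-valued measures with finite outcome set `X`. -/
structure IsPOVM (M : X → Matrix n n ℂ) : Prop where
  posSemidef : ∀ x, (M x).PosSemidef
  sum_eq_one : ∑ x, M x = 1

/-- The map `1 ⊗ Ψ` acting on the second tensor factor. -/
def idTensor (R : Type*) (Ψ : Matrix A A ℂ →ₗ[ℂ] Matrix B B ℂ) :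
    Matrix (R × A) (R × A) ℂ →ₗ[ℂ] Matrix (R × B) (R × B) ℂ where
  toFun Z := Matrix.of fun u v => Ψ (Matrix.of fun a a' => Z (u.1, a) (v.1, a')) u.2 v.2
  map_add' Z W := by
    ext u v
    exact congrFun (congrFun (Ψ.map_add (Matrix.of fun a a' => Z (u.1, a) (v.1, a'))
      (Matrix.of fun a a' => W (u.1, a) (v.1, a'))) u.2) v.2
  map_smul' c Z := by
    ext u v
    exact congrFun (congrFun (Ψ.map_smul c (Matrix.of fun a a' => Z (u.1, a) (v.1, a'))) u.2) v.2

/-- The map `Φ ⊗ 1` acting on the first tensor factor. -/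
def tensorId (B : Type*) (Φ : Matrix R R ℂ →ₗ[ℂ] Matrix A A ℂ) :
    Matrix (R × B) (R × B) ℂ →ₗ[ℂ] Matrix (A × B) (A × B) ℂ where
  toFun Z := Matrix.of fun u v => Φ (Matrix.of fun r r' => Z (r, u.2) (r', v.2)) u.1 v.1
  map_add' Z W := by
    ext u v
    exact congrFun (congrFun (Φ.map_add (Matrix.of fun r r' => Z (r, u.2) (r', v.2))
      (Matrix.of fun r r' => W (r, u.2) (r', v.2))) u.1) v.1
  map_smul' c Z := by
    ext u v
    exact congrFun (congrFun (Φ.map_smul c (Matrix.of fun r r' => Z (r, u.2) (r', v.2))) u.1) v.1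

theorem idTensor_kronecker (Ψ : Matrix A A ℂ →ₗ[ℂ] Matrix B B ℂ)
    (S : Matrix R R ℂ) (T : Matrix A A ℂ) : idTensor R Ψ (S ⊗ₖ T) = S ⊗ₖ Ψ T := by
  ext u v
  exact congrFun (congrFun (Ψ.map_smul (S u.1 v.1) T) u.2) v.2

theorem tensorId_kronecker (Φ : Matrix R R ℂ →ₗ[ℂ] Matrix A A ℂ)
    (S : Matrix R R ℂ) (T : Matrix B B ℂ) : tensorId B Φ (S ⊗ₖ T) = Φ S ⊗ₖ T := by
  ext u v
  have h := congrFun (congrFun (Φ.map_smul (T u.2 v.2) S) u.1) v.1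
  have e : (Matrix.of fun r r' => (S ⊗ₖ T) (r, u.2) (r', v.2)) = T u.2 v.2 • S := by
    ext r r'
    simp [mul_comm]
  change Φ (Matrix.of fun r r' => (S ⊗ₖ T) (r, u.2) (r', v.2)) u.1 v.1 = _
  rw [e, h]
  simp [mul_comm]

/-- Quantum channels `A → B`: completely positive trace-preserving linear maps. -/
structure IsChannel (Ψ : Matrix A A ℂ →ₗ[ℂ] Matrix B B ℂ) : Prop where
  completelyPositive : ∀ (k : ℕ) (Z : Matrix (Fin k × A) (Fin k × A) ℂ),
    Z.PosSemidef → (idTensor (Fin k) Ψ Z).PosSemidef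
  tracePreserving : ∀ Z : Matrix A A ℂ, (Ψ Z).trace = Z.trace

/-- The unnormalized maximally entangled operator `φ₊ = ∑ i j, |i i⟩⟨j j|` on two copies of `A`. -/
def maxEntangled (A : Type*) [DecidableEq A] : Matrix (A × A) (A × A) ℂ :=
  Matrix.of fun u v => (if u.1 = u.2 then 1 else 0) * (if v.1 = v.2 then 1 else 0)

/-- The linear map `Υ_ρ : L(A) → L(R)` with `(Υ_ρ ⊗ 1)(φ₊) = ρ`. -/
def upsilon (ρ : Matrix (R × A) (R × A) ℂ) : Matrix A A ℂ →ₗ[ℂ] Matrix R R ℂ where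
  toFun Z := Matrix.of fun r r' => ∑ i, ∑ j, Z i j * ρ (r, i) (r', j)
  map_add' Z W := by
    ext r r'
    simp [add_mul, Finset.sum_add_distrib]
  map_smul' c Z := by
    ext r r'
    simp [Finset.mul_sum, mul_assoc]

theorem tensorId_upsilon_maxEntangled (ρ : Matrix (R × A) (R × A) ℂ) :
    tensorId A (upsilon ρ) (maxEntangled A) = ρ := by
  ext ⟨r, k⟩ ⟨r', l⟩
  simp [tensorId, upsilon, maxEntangled]

/-- The dual of a superoperator for the Hilbert–Schmidt inner product `Tr[Sᴴ T]`. -/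
def dualMap (Φ : Matrix A A ℂ →ₗ[ℂ] Matrix R R ℂ) : Matrix R R ℂ →ₗ[ℂ] Matrix A A ℂ where
  toFun Z := Matrix.of fun i j => ((Φ (Matrix.single i j 1)).conjTranspose * Z).trace
  map_add' Z W := by
    ext i j
    simp [mul_add]
  map_smul' c Z := by
    ext i j
    simp

theorem trace_dualMap (Φ : Matrix A A ℂ →ₗ[ℂ] Matrix R R ℂ) (S : Matrix A A ℂ)
    (T : Matrix R R ℂ) :
    ((Φ S).conjTranspose * T).trace = (S.conjTranspose * dualMap Φ T).trace := by
  have hS : Φ S = ∑ i, ∑ j, S i j • Φ (Matrix.single i j 1) := by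
    conv_lhs => rw [Matrix.matrix_eq_sum_single S]
    simp only [map_sum, ← map_smul, Matrix.smul_single, smul_eq_mul, mul_one]
  rw [hS]
  simp only [Matrix.conjTranspose_sum, Matrix.conjTranspose_smul, Finset.sum_mul,
    Matrix.smul_mul, Matrix.trace_sum, Matrix.trace_smul]
  rw [Finset.sum_comm]
  simp [Matrix.trace, Matrix.mul_apply, dualMap]

/-- A process-channel measurement of channels `A → B` with reference system `R` and outcome set
`X`: a state of `R ⊗ A` together with a POVM on `R ⊗ B`. -/
structure Tester (R A B X : Type*) [Fintype R] [DecidableEq R] [Fintype A] [DecidableEq A]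
    [Fintype B] [DecidableEq B] [Fintype X] where
  state : Matrix (R × A) (R × A) ℂ
  povm : X → Matrix (R × B) (R × B) ℂ
  isState : IsState state
  isPOVM : IsPOVM povm

/-- The outcome probabilities `p_x = Tr[M_x (1 ⊗ Ψ)(ρ)]` (a real number). -/
def Tester.prob (T : Tester R A B X) (Ψ : Matrix A A ℂ →ₗ[ℂ] Matrix B B ℂ) (x : X) : ℝ :=
  (T.povm x * idTensor R Ψ T.state).trace.re

/-- The process-channel effects `E_x = (Υ_ρ* ⊗ 1)(M_x)`. -/
def Tester.effect (T : Tester R A B X) (x : X) : Matrix (A × B) (A × B) ℂ :=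
  tensorId B (dualMap (upsilon T.state)) (T.povm x)

/-- The reduced state `ρ^A = Tr_R[ρ]`. -/
def Tester.reducedState (T : Tester R A B X) : Matrix A A ℂ :=
  Matrix.of fun a a' => ∑ r, T.state (r, a) (r, a')

/-- The completed process effects: the process effects together with the effect
`1 - (ρ^A)ᵀ ⊗ 1` attached to an additional outcome `none`. -/
def Tester.completedEffect (T : Tester R A B X) : Option X → Matrix (A × B) (A × B) ℂ
  | some x => T.effect x
  | none => 1 - T.reducedState.transpose ⊗ₖ (1 : Matrix B B ℂ)

open scoped MatrixOrder Matrix.Norms.L2Operator in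
/-- The overlap `‖Ẽ_x^{1/2} F̃_y^{1/2}‖` in operator norm, the square roots being the positive
semidefinite ones. -/
def overlap (T₁ : Tester R A B X) (T₂ : Tester R A B Y) (x : Option X) (y : Option Y) : ℝ :=
  ‖CFC.sqrt (T₁.completedEffect x) * CFC.sqrt (T₂.completedEffect y)‖

/-- The maximum overlap of two testers. -/
def maxOverlap (T₁ : Tester R A B X) (T₂ : Tester R A B Y) : ℝ :=
  (Finset.univ : Finset (Option X × Option Y)).sup' Finset.univ_nonempty
    fun z => overlap T₁ T₂ z.1 z.2

/-- The vector `(1/d) p ⊕ (d-1)/d`. -/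
def paddedVector (d : ℕ) (p : X → ℝ) : Option X → ℝ
  | some x => (1 / (d : ℝ)) * p x
  | none => ((d : ℝ) - 1) / (d : ℝ)

/-- The Rényi entropy of order `α ∈ (0, ∞]` of a probability vector on a finite set, with its usual
values at `α = 1` (Shannon entropy) and `α = ∞` (min-entropy). -/
def renyiEntropy (α : ℝ≥0∞) (p : ι → ℝ) : ℝ :=
  if α = 1 then ∑ i, Real.negMulLog (p i)
  else if α = ∞ then -Real.log (⨆ i, p i)
  else (1 / (1 - α.toReal)) * Real.log (∑ i, p i ^ α.toReal)

end Basic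

end ProcessMU

end

open ProcessMU

/-- The holomorphic power `z ↦ p ^ (s * (1 + z))` of a real base, extended by zero to `p = 0`. -/
noncomputable def stripPower (p s : ℝ) (z : ℂ) : ℂ :=
  if p = 0 then 0 else (p : ℂ) ^ ((s : ℂ) * (1 + z))

theorem differentiable_stripPower (p s : ℝ) : Differentiable ℂ (stripPower p s) := by
  unfold stripPower
  by_cases hp : p = 0
  · simp [hp]
  · simp only [hp, if_false]
    have : (p : ℂ) ≠ 0 := by exact_mod_cast hp
    intro z
    exact DifferentiableAt.const_cpow (by fun_prop) (Or.inl this)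

theorem norm_stripPower {p s : ℝ} (hp : 0 ≤ p) (hs : 0 < s) {z : ℂ} (hz : 0 ≤ z.re) :
    ‖stripPower p s z‖ = p ^ (s * (1 + z.re)) := by
  unfold stripPower
  rcases hp.eq_or_lt with rfl | hp
  · simp [Real.zero_rpow (show s * (1 + z.re) ≠ 0 by positivity)]
  · simp [hp.ne', Complex.norm_cpow_eq_rpow_re_of_pos hp]

theorem stripPower_ofReal {p s t : ℝ} (hp : 0 ≤ p) (hs : 0 < s) (ht : 0 ≤ t) :
    stripPower p s t = ((p ^ (s * (1 + t)) : ℝ) : ℂ) := by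
  unfold stripPower
  rcases hp.eq_or_lt with rfl | hp
  · simp [Real.zero_rpow (show s * (1 + t) ≠ 0 by positivity)]
  · simp [hp.ne', Complex.ofReal_cpow hp.le]

theorem exists_ne_zero_of_sum_eq_one {ι : Type*} [Fintype ι] {p : ι → ℝ} (hp : ∑ i, p i = 1) :
    ∃ i, p i ≠ 0 := by
  by_contra! h
  simp [h] at hp

theorem sum_rpow_pos {ι : Type*} [Fintype ι] {p : ι → ℝ} (hp : ∀ i, 0 ≤ p i)
    (hp₁ : ∑ i, p i = 1) (s : ℝ) : 0 < ∑ i, p i ^ s := by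
  obtain ⟨i, hi⟩ := exists_ne_zero_of_sum_eq_one hp₁
  exact Finset.sum_pos' (fun j _ => Real.rpow_nonneg (hp j) _)
    ⟨i, Finset.mem_univ _, Real.rpow_pos_of_pos ((hp i).lt_of_ne' hi) _⟩

/-- Riesz–Thorin interpolation between `ℓ² → ℓ²` and `ℓ¹ → ℓ^∞`, for a kernel `K` mapping the
amplitudes of `P` to those of `Q`. -/
theorem log_sum_rpow_le_of_kernel {X Y : Type*} [Fintype X] [Fintype Y] (K : X → Y → ℂ) {c : ℝ}
    (hK : ∀ x y, ‖K x y‖ ≤ c)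
    (hK₂ : ∀ (a : X → ℂ) (b : Y → ℂ),
      ‖∑ x, ∑ y, a x * b y * K x y‖ ≤ √(∑ x, ‖a x‖ ^ 2) * √(∑ y, ‖b y‖ ^ 2))
    {P : X → ℝ} {Q : Y → ℝ} (hP : ∀ x, 0 ≤ P x) (hQ : ∀ y, 0 ≤ Q y)
    (hP₁ : ∑ x, P x = 1) (hQ₁ : ∑ y, Q y = 1)
    (hPQ : ∀ y, ∑ x, (√(P x) : ℂ) * K x y = √(Q y)) {t : ℝ} (ht₀ : 0 < t) (ht₁ : t < 1) :
    0 < c ∧ (1 - t) * Real.log (∑ y, Q y ^ (1 / (1 - t)))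
      ≤ 2 * t * Real.log c + (1 + t) * Real.log (∑ x, P x ^ (1 / (1 + t))) := by
  have h1t : 0 < 1 - t := by linarith
  have hPle : ∀ x, P x ≤ 1 := fun x => hP₁ ▸
    Finset.single_le_sum (fun i _ => hP i) (Finset.mem_univ x)
  have hQle : ∀ y, Q y ≤ 1 := fun y => hQ₁ ▸
    Finset.single_le_sum (fun i _ => hQ i) (Finset.mem_univ y)
  set A := ∑ x, P x ^ (1 / (1 + t)) with hA
  set B := ∑ y, Q y ^ (1 / (1 - t)) with hB
  have hA0 : 0 < A := sum_rpow_pos hP hP₁ _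
  have hB0 : 0 < B := sum_rpow_pos hQ hQ₁ _
  set r : ℝ := 1 / (2 * (1 + t)) with hr
  set s : ℝ := 1 / (2 * (1 - t)) with hs
  have hr0 : 0 < r := by positivity
  have hs0 : 0 < s := by positivity
  let f : ℂ → ℂ := fun z => ∑ x, ∑ y, stripPower (P x) r z * stripPower (Q y) s z * K x y
  have hf : Differentiable ℂ f := by
    refine Differentiable.fun_sum fun x _ => Differentiable.fun_sum fun y _ => ?_
    exact ((differentiable_stripPower _ _).mul (differentiable_stripPower _ _)).mul_const _
  have hbound : ∀ z : ℂ, 0 ≤ z.re → ‖f z‖ ≤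
      ∑ x, ∑ y, P x ^ (r * (1 + z.re)) * Q y ^ (s * (1 + z.re)) * ‖K x y‖ := by
    intro z hz
    refine (norm_sum_le _ _).trans (Finset.sum_le_sum fun x _ => ?_)
    refine (norm_sum_le _ _).trans (Finset.sum_le_sum fun y _ => ?_)
    rw [norm_mul, norm_mul, norm_stripPower (hP x) hr0 hz, norm_stripPower (hQ y) hs0 hz]
  have hft : f t = (B : ℂ) := by
    have e1 : r * (1 + t) = 1 / 2 := by rw [hr]; field_simp
    have e2 : s * (1 + t) + 1 / 2 = 1 / (1 - t) := by rw [hs]; field_simp; ring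
    simp only [f]
    rw [Finset.sum_comm, hB, Complex.ofReal_sum]
    refine Finset.sum_congr rfl fun y _ => ?_
    rw [← e2, Real.rpow_add_of_nonneg (hQ y) (by positivity) (by norm_num), Complex.ofReal_mul,
      ← Real.sqrt_eq_rpow, ← hPQ y, Finset.mul_sum]
    refine Finset.sum_congr rfl fun x _ => ?_
    rw [stripPower_ofReal (hP x) hr0 ht₀.le, stripPower_ofReal (hQ y) hs0 ht₀.le, e1,
      ← Real.sqrt_eq_rpow]
    ring
  have h3 := Complex.HadamardThreeLines.norm_le_interp_of_mem_verticalClosedStrip'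
    (f := f) (z := (t : ℂ)) (a := √A * √B) (b := c * A * B) (l := 0) (u := 1) one_pos
    (by simp [Complex.HadamardThreeLines.verticalClosedStrip, ht₀.le, ht₁.le])
    hf.diffContOnCl
    (by
      refine ⟨∑ x, ∑ y, ‖K x y‖, ?_⟩
      rintro _ ⟨z, hz, rfl⟩
      have hz0 : 0 ≤ z.re := hz.1
      refine (hbound z hz0).trans (Finset.sum_le_sum fun x _ => Finset.sum_le_sum fun y _ => ?_)
      refine mul_le_of_le_one_left (norm_nonneg _) (mul_le_one₀ ?_ (Real.rpow_nonneg (hQ y) _) ?_)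
      · exact Real.rpow_le_one (hP x) (hPle x) (by positivity)
      · exact Real.rpow_le_one (hQ y) (hQle y) (by positivity))
    (by
      intro z hz
      have hz0 : z.re = 0 := hz
      refine (hK₂ _ _).trans (le_of_eq ?_)
      congr 2
      · refine Finset.sum_congr rfl fun x _ => ?_
        rw [norm_stripPower (hP x) hr0 hz0.ge, ← Real.rpow_mul_natCast (hP x), hz0]
        congr 1; rw [hr]; push_cast; field_simp; ring
      · refine Finset.sum_congr rfl fun y _ => ?_
        rw [norm_stripPower (hQ y) hs0 hz0.ge, ← Real.rpow_mul_natCast (hQ y), hz0]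
        congr 1; rw [hs]; push_cast; field_simp; ring)
    (by
      intro z hz
      have hz1 : z.re = 1 := hz
      refine (hbound z (by simp [hz1])).trans ?_
      have e1 : r * (1 + 1) = 1 / (1 + t) := by rw [hr]; field_simp; ring
      have e2 : s * (1 + 1) = 1 / (1 - t) := by rw [hs]; field_simp; ring
      rw [hz1, e1, e2, mul_assoc, hA, hB, Finset.sum_mul_sum, Finset.mul_sum]
      refine Finset.sum_le_sum fun x _ => ?_
      rw [Finset.mul_sum]
      refine Finset.sum_le_sum fun y _ => ?_
      rw [mul_comm c]
      exact mul_le_mul_of_nonneg_left (hK x y)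
        (mul_nonneg (Real.rpow_nonneg (hP x) _) (Real.rpow_nonneg (hQ y) _)))
  rw [hft, Complex.norm_real, Real.norm_of_nonneg hB0.le, Complex.ofReal_re, sub_zero, sub_zero,
    div_one] at h3
  have hc0 : 0 ≤ c := by
    obtain ⟨x, -⟩ := exists_ne_zero_of_sum_eq_one hP₁
    obtain ⟨y, -⟩ := exists_ne_zero_of_sum_eq_one hQ₁
    exact (norm_nonneg _).trans (hK x y)
  have hc : 0 < c := by
    refine hc0.lt_of_ne ?_
    rintro rfl
    rw [zero_mul, zero_mul, Real.zero_rpow ht₀.ne', mul_zero] at h3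
    exact hB0.not_ge h3
  refine ⟨hc, ?_⟩
  have h4 := Real.log_le_log hB0 h3
  rw [Real.log_mul (by positivity) (by positivity), Real.log_rpow (by positivity),
    Real.log_rpow (by positivity), Real.log_mul (by positivity) (by positivity),
    Real.log_mul (by positivity) (by positivity), Real.log_mul (by positivity) (by positivity),
    Real.log_sqrt hA0.le, Real.log_sqrt hB0.le] at h4
  linarith

section Operators

variable {H X Y : Type*} [NormedAddCommGroup H] [InnerProductSpace ℂ H] [CompleteSpace H]
  [Fintype X] [Fintype Y]

theorem inner_apply_of_isSelfAdjoint {a : H →L[ℂ] H} (ha : IsSelfAdjoint a) (u v : H) :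
    inner ℂ (a u) v = inner ℂ u (a v) := by
  conv_lhs => rw [← ContinuousLinearMap.isSelfAdjoint_iff'.1 ha]
  exact ContinuousLinearMap.adjoint_inner_left _ _ _

theorem sum_norm_apply_sq {e : X → H →L[ℂ] H} (he : ∀ x, IsSelfAdjoint (e x))
    (he₁ : ∑ x, e x * e x = 1) (u : H) : ∑ x, ‖e x u‖ ^ 2 = ‖u‖ ^ 2 := by
  have h : ∑ x, inner ℂ (e x u) (e x u) = inner ℂ u u := by
    simp_rw [fun x => inner_apply_of_isSelfAdjoint (he x), ← inner_sum]
    congr 1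
    simpa using congrArg (fun a : H →L[ℂ] H => a u) he₁
  simp only [inner_self_eq_norm_sq_to_K] at h
  exact_mod_cast h

/-- The synthesis operator of a resolution of the identity is a contraction. -/
theorem norm_sum_apply_le {e : X → H →L[ℂ] H} (he : ∀ x, IsSelfAdjoint (e x))
    (he₁ : ∑ x, e x * e x = 1) (w : X → H) :
    ‖∑ x, e x (w x)‖ ≤ √(∑ x, ‖w x‖ ^ 2) := by
  set s := ∑ x, e x (w x) with hs
  have h : ‖s‖ ^ 2 ≤ ‖s‖ * √(∑ x, ‖w x‖ ^ 2) := by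
    calc ‖s‖ ^ 2 = ‖inner ℂ s s‖ := by
          rw [inner_self_eq_norm_sq_to_K]; simp
      _ = ‖∑ x, inner ℂ (e x s) (w x)‖ := by
          conv_lhs => rw [hs, inner_sum, ← hs]
          simp_rw [fun x => inner_apply_of_isSelfAdjoint (he x)]
      _ ≤ ∑ x, ‖e x s‖ * ‖w x‖ :=
          (norm_sum_le _ _).trans (Finset.sum_le_sum fun x _ => norm_inner_le_norm _ _)
      _ ≤ √(∑ x, ‖e x s‖ ^ 2) * √(∑ x, ‖w x‖ ^ 2) := Real.sum_mul_le_sqrt_mul_sqrt _ _ _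
      _ = ‖s‖ * √(∑ x, ‖w x‖ ^ 2) := by
          rw [sum_norm_apply_sq he he₁, Real.sqrt_sq (norm_nonneg _)]
  rcases (norm_nonneg s).eq_or_lt with h0 | h0
  · rw [← h0]; positivity
  · exact le_of_mul_le_mul_left (by rwa [← sq]) h0

theorem exists_unit_direction (u : H) : ∃ d : H, ‖d‖ ≤ 1 ∧ (‖u‖ : ℂ) • d = u := by
  refine ⟨((‖u‖⁻¹ : ℝ) : ℂ) • u, ?_, ?_⟩
  · rw [norm_smul, Complex.norm_real, norm_inv, norm_norm]
    exact inv_mul_le_one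
  · rcases eq_or_ne u 0 with rfl | hu
    · simp
    · rw [smul_smul, ← Complex.ofReal_mul, mul_inv_cancel₀ (norm_ne_zero_iff.2 hu)]
      simp

theorem log_sum_rpow_le_of_operators {e : X → H →L[ℂ] H} {f : Y → H →L[ℂ] H}
    (he : ∀ x, IsSelfAdjoint (e x)) (he₁ : ∑ x, e x * e x = 1)
    (hf : ∀ y, IsSelfAdjoint (f y)) (hf₁ : ∑ y, f y * f y = 1) {c : ℝ}
    (hc : ∀ x y, ‖f y * e x‖ ≤ c) {ψ : H} (hψ : ‖ψ‖ = 1) {t : ℝ} (ht₀ : 0 < t) (ht₁ : t < 1) :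
    0 < c ∧ (1 - t) * Real.log (∑ y, (‖f y ψ‖ ^ 2) ^ (1 / (1 - t)))
      ≤ 2 * t * Real.log c + (1 + t) * Real.log (∑ x, (‖e x ψ‖ ^ 2) ^ (1 / (1 + t))) := by
  choose u hu₁ hu using fun x => exists_unit_direction (e x ψ)
  choose v hv₁ hv using fun y => exists_unit_direction (f y ψ)
  refine log_sum_rpow_le_of_kernel (fun x y => inner ℂ (v y) (f y (e x (u x)))) ?_ ?_
    (fun x => by positivity) (fun y => by positivity)
    (by rw [sum_norm_apply_sq he he₁, hψ, one_pow]) (by rw [sum_norm_apply_sq hf hf₁, hψ, one_pow])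
    ?_ ht₀ ht₁
  · intro x y
    calc ‖inner ℂ (v y) (f y (e x (u x)))‖ ≤ ‖v y‖ * ‖(f y * e x) (u x)‖ := norm_inner_le_norm _ _
      _ ≤ 1 * (c * 1) := by
        refine mul_le_mul (hv₁ y) ?_ (norm_nonneg _) zero_le_one
        refine (ContinuousLinearMap.le_opNorm _ _).trans ?_
        exact mul_le_mul (hc x y) (hu₁ x) (norm_nonneg _) ((norm_nonneg _).trans (hc x y))
      _ = c := by ring
  · intro a b
    have h : ∑ x, ∑ y, a x * b y * inner ℂ (v y) (f y (e x (u x)))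
        = inner ℂ (∑ y, f y (star (b y) • v y)) (∑ x, e x (a x • u x)) := by
      rw [inner_sum]
      refine Finset.sum_congr rfl fun x _ => ?_
      rw [sum_inner]
      refine Finset.sum_congr rfl fun y _ => ?_
      rw [inner_apply_of_isSelfAdjoint (hf y), map_smul, map_smul, inner_smul_left,
        inner_smul_right]
      simp
      ring
    rw [h, mul_comm]
    refine (norm_inner_le_norm _ _).trans ?_
    refine mul_le_mul ((norm_sum_apply_le hf hf₁ _).trans ?_)
      ((norm_sum_apply_le he he₁ _).trans ?_) (norm_nonneg _) (Real.sqrt_nonneg _)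
    · refine Real.sqrt_le_sqrt (Finset.sum_le_sum fun y _ => ?_)
      rw [norm_smul, norm_star]
      exact pow_le_pow_left₀ (by positivity) (mul_le_of_le_one_right (norm_nonneg _) (hv₁ y)) 2
    · refine Real.sqrt_le_sqrt (Finset.sum_le_sum fun x _ => ?_)
      rw [norm_smul]
      exact pow_le_pow_left₀ (by positivity) (mul_le_of_le_one_right (norm_nonneg _) (hu₁ x)) 2
  · intro y
    have h : ∑ x, e x (e x ψ) = ψ := by
      simpa using congrArg (fun a : H →L[ℂ] H => a ψ) he₁
    simp_rw [fun x => Real.sqrt_sq (norm_nonneg (e x ψ)), Real.sqrt_sq (norm_nonneg (f y ψ)),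
      ← inner_smul_right, ← map_smul, hu]
    rw [← inner_sum, ← map_sum, h]
    conv_lhs => rw [← hv y]
    rw [inner_smul_right, inner_self_eq_norm_sq_to_K]
    rcases eq_or_ne (f y ψ) 0 with h0 | h0
    · simp [h0]
    · have h1 : ‖f y ψ‖ * ‖v y‖ = ‖f y ψ‖ := by
        conv_rhs => rw [← hv y, norm_smul, Complex.norm_real, norm_norm]
      have h2 : ‖v y‖ = 1 := mul_left_cancel₀ (norm_ne_zero_iff.2 h0) (by rw [h1, mul_one])
      simp [h2]

theorem norm_apply_sq_le_of_operators {e : X → H →L[ℂ] H} {f : Y → H →L[ℂ] H}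
    (he₁ : ∑ x, e x * e x = 1) {c : ℝ} (hc : ∀ x y, ‖f y * e x‖ ≤ c) (ψ : H) (y : Y) :
    ‖f y ψ‖ ^ 2 ≤ (c * ∑ x, √(‖e x ψ‖ ^ 2)) ^ 2 := by
  have h : ∑ x, e x (e x ψ) = ψ := by
    simpa using congrArg (fun a : H →L[ℂ] H => a ψ) he₁
  refine pow_le_pow_left₀ (norm_nonneg _) ?_ 2
  conv_lhs => rw [← h, map_sum]
  rw [Finset.mul_sum]
  refine (norm_sum_le _ _).trans (Finset.sum_le_sum fun x _ => ?_)
  rw [Real.sqrt_sq (norm_nonneg _)]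
  exact (f y * e x).le_of_opNorm_le (hc x y) _

end Operators

section Renyi

variable {X Y : Type*} [Fintype X] [Fintype Y]

theorem hasDerivAt_sum_rpow_one {p : X → ℝ} (hp : ∀ x, 0 ≤ p x) :
    HasDerivAt (fun s : ℝ => ∑ x, p x ^ s) (-∑ x, Real.negMulLog (p x)) 1 := by
  rw [← Finset.sum_neg_distrib]
  refine HasDerivAt.fun_sum fun x _ => ?_
  rcases (hp x).eq_or_lt with h | h
  · rw [← h, Real.negMulLog_zero, neg_zero]
    refine (hasDerivAt_const (1 : ℝ) (0 : ℝ)).congr_of_eventuallyEq ?_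
    filter_upwards [eventually_ne_nhds (one_ne_zero : (1 : ℝ) ≠ 0)] with s hs
    exact Real.zero_rpow hs
  · simpa [Real.negMulLog, mul_comm] using (hasDerivAt_id' (1 : ℝ)).const_rpow h

/-- Rényi entropies tend to the Shannon entropy as the order tends to one. -/
theorem tendsto_renyiEntropy_one {p : X → ℝ} (hp : ∀ x, 0 ≤ p x) (hp₁ : ∑ x, p x = 1) :
    Filter.Tendsto (fun s : ℝ => 1 / (1 - s) * Real.log (∑ x, p x ^ s)) (nhdsWithin 1 {1}ᶜ)
      (nhds (∑ x, Real.negMulLog (p x))) := by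
  have h := ((hasDerivAt_sum_rpow_one hp).log (by simp [hp₁])).tendsto_slope.neg
  simp only [Real.rpow_one, hp₁, div_one, neg_neg] at h
  refine h.congr fun s => ?_
  simp only [slope_def_field, Real.rpow_one, hp₁, Real.log_one, sub_zero]
  rw [← neg_sub s 1, div_neg]
  ring

theorem renyi_add_renyi_ge {P : X → ℝ} {Q : Y → ℝ} {c t : ℝ}
    (ht₀ : 0 < t) (ht₁ : t < 1)
    (h : (1 - t) * Real.log (∑ y, Q y ^ (1 / (1 - t)))
      ≤ 2 * t * Real.log c + (1 + t) * Real.log (∑ x, P x ^ (1 / (1 + t)))) :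
    -2 * Real.log c ≤ 1 / (1 - 1 / (1 + t)) * Real.log (∑ x, P x ^ (1 / (1 + t)))
      + 1 / (1 - 1 / (1 - t)) * Real.log (∑ y, Q y ^ (1 / (1 - t))) := by
  have h1t : 0 < 1 - t := by linarith
  have e1 : 1 / (1 - 1 / (1 + t)) = (1 + t) / t := by
    have : 1 - 1 / (1 + t) = t / (1 + t) := by field_simp; ring
    rw [this, one_div_div]
  have e2 : 1 / (1 - 1 / (1 - t)) = -((1 - t) / t) := by
    have : 1 - 1 / (1 - t) = -(t / (1 - t)) := by field_simp; ring
    rw [this, one_div, inv_neg, inv_div]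
  rw [e1, e2]
  have : 0 ≤ (2 * t * Real.log c + (1 + t) * Real.log (∑ x, P x ^ (1 / (1 + t)))
    - (1 - t) * Real.log (∑ y, Q y ^ (1 / (1 - t)))) / t := div_nonneg (by linarith) ht₀.le
  refine le_of_sub_nonneg (this.trans_eq ?_)
  field_simp
  ring

/-- Shannon entropies inherit an uncertainty relation from conjugate Rényi entropies. -/
theorem shannon_add_shannon_ge {P : X → ℝ} {Q : Y → ℝ} {c : ℝ}
    (hP : ∀ x, 0 ≤ P x) (hQ : ∀ y, 0 ≤ Q y) (hP₁ : ∑ x, P x = 1) (hQ₁ : ∑ y, Q y = 1)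
    (h : ∀ t : ℝ, 0 < t → t < 1 → (1 - t) * Real.log (∑ y, Q y ^ (1 / (1 - t)))
      ≤ 2 * t * Real.log c + (1 + t) * Real.log (∑ x, P x ^ (1 / (1 + t)))) :
    -2 * Real.log c ≤ ∑ x, Real.negMulLog (P x) + ∑ y, Real.negMulLog (Q y) := by
  have lim : ∀ k : ℝ, k ≠ 0 → Filter.Tendsto (fun t : ℝ => 1 / (1 + k * t))
      (nhdsWithin 0 (Set.Ioi 0)) (nhdsWithin 1 {1}ᶜ) := by
    intro k hk
    refine tendsto_nhdsWithin_iff.2 ⟨?_, ?_⟩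
    · have : ContinuousAt (fun t : ℝ => 1 / (1 + k * t)) 0 := by
        refine ContinuousAt.div (by fun_prop) (by fun_prop) (by simp)
      have h := this.tendsto
      simp only [mul_zero, add_zero, div_one] at h
      exact h.mono_left nhdsWithin_le_nhds
    · filter_upwards [self_mem_nhdsWithin] with t ht h1
      have h1 : 1 / (1 + k * t) = 1 := h1
      have h2 : 1 + k * t ≠ 0 := fun h0 => by simp [h0] at h1
      rw [div_eq_one_iff_eq h2] at h1
      exact mul_ne_zero hk (ne_of_gt ht) (by linarith)
  have l1 := (tendsto_renyiEntropy_one hP hP₁).comp (lim 1 one_ne_zero)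
  have l2 := (tendsto_renyiEntropy_one hQ hQ₁).comp (lim (-1) (by norm_num))
  refine ge_of_tendsto (l1.add l2) ?_
  filter_upwards [Ioo_mem_nhdsGT (one_pos : (0 : ℝ) < 1)] with t ht
  simpa [Function.comp, ← sub_eq_add_neg] using renyi_add_renyi_ge ht.1 ht.2 (h t ht.1 ht.2)

theorem minEntropy_add_renyi_half_ge {P : X → ℝ} {Q : Y → ℝ} {c : ℝ} (hc : 0 < c)
    (hP : ∀ x, 0 ≤ P x) (hQ : ∀ y, 0 ≤ Q y) (hP₁ : ∑ x, P x = 1) (hQ₁ : ∑ y, Q y = 1)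
    (h : ∀ y, Q y ≤ (c * ∑ x, √(P x)) ^ 2) :
    -2 * Real.log c ≤ 2 * Real.log (∑ x, P x ^ (1 / 2 : ℝ)) + -Real.log (⨆ y, Q y) := by
  obtain ⟨y, hy⟩ := exists_ne_zero_of_sum_eq_one hQ₁
  have : Nonempty Y := ⟨y⟩
  have hpos : 0 < ⨆ y, Q y :=
    ((hQ y).lt_of_ne' hy).trans_le (le_ciSup (Set.finite_range Q).bddAbove y)
  have hle := Real.log_le_log hpos (ciSup_le h)
  simp_rw [Real.sqrt_eq_rpow] at hle
  rw [Real.log_pow, Real.log_mul hc.ne' (sum_rpow_pos hP hP₁ _).ne'] at hle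
  push_cast at hle
  linarith

/-- Combination of all orders `1 / α + 1 / β = 2` with `1 ≤ β`. -/
theorem renyiEntropy_add_ge_of_one_le {P : X → ℝ} {Q : Y → ℝ} {c : ℝ} (hc : 0 < c)
    (hP : ∀ x, 0 ≤ P x) (hQ : ∀ y, 0 ≤ Q y) (hP₁ : ∑ x, P x = 1) (hQ₁ : ∑ y, Q y = 1)
    (h : ∀ t : ℝ, 0 < t → t < 1 → (1 - t) * Real.log (∑ y, Q y ^ (1 / (1 - t)))
      ≤ 2 * t * Real.log c + (1 + t) * Real.log (∑ x, P x ^ (1 / (1 + t))))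
    (hinf : ∀ y, Q y ≤ (c * ∑ x, √(P x)) ^ 2)
    {α β : ℝ≥0∞} (hαβ : 1 / α + 1 / β = 2) (hβ : 1 ≤ β) :
    -2 * Real.log c ≤ renyiEntropy α P + renyiEntropy β Q := by
  rw [one_div, one_div] at hαβ
  have hα₀ : α ≠ 0 := by
    rintro rfl
    simp at hαβ
  have hβ₀ : β ≠ 0 := (zero_lt_one.trans_le hβ).ne'
  have hα : α ≠ ∞ := by
    rintro rfl
    rw [ENNReal.inv_top, zero_add] at hαβ
    have := ENNReal.inv_le_one.2 hβ
    rw [hαβ] at this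
    norm_num at this
  have hr : α.toReal⁻¹ + β.toReal⁻¹ = 2 := by
    rw [← ENNReal.toReal_inv, ← ENNReal.toReal_inv, ← ENNReal.toReal_add
      (ENNReal.inv_ne_top.2 hα₀) (ENNReal.inv_ne_top.2 hβ₀), hαβ]
    simp
  have hαpos : 0 < α.toReal := ENNReal.toReal_pos hα₀ hα
  rcases eq_or_ne β ∞ with rfl | hβt
  · have hα2 : α.toReal = 1 / 2 := by
      rw [ENNReal.toReal_top, inv_zero, add_zero] at hr
      rw [← inv_inv α.toReal, hr, one_div]
    have hα1 : α ≠ 1 := by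
      rintro rfl
      norm_num at hα2
    have := minEntropy_add_renyi_half_ge hc hP hQ hP₁ hQ₁ hinf
    simp only [renyiEntropy, hα1, hα, hα2, ENNReal.top_ne_one, if_false, if_true]
    norm_num at this ⊢
    linarith
  · have hβpos : 0 < β.toReal := ENNReal.toReal_pos hβ₀ hβt
    rcases eq_or_ne β 1 with rfl | hβ1
    · have hα1 : α = 1 := by
        rw [← ENNReal.toReal_eq_one_iff]
        rw [ENNReal.toReal_one, inv_one] at hr
        exact inv_eq_one.1 (by linarith)
      simp only [renyiEntropy, hα1, if_true]
      exact shannon_add_shannon_ge hP hQ hP₁ hQ₁ h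
    · have hβ1' : 1 < β.toReal := by
        rw [← ENNReal.toReal_one, ENNReal.toReal_lt_toReal ENNReal.one_ne_top hβt]
        exact lt_of_le_of_ne hβ hβ1.symm
      have hinv := inv_lt_one_of_one_lt₀ hβ1'
      have hinv0 : 0 < β.toReal⁻¹ := by positivity
      have hα1 : α ≠ 1 := by
        rintro rfl
        rw [ENNReal.toReal_one, inv_one] at hr
        linarith
      have key := renyi_add_renyi_ge (t := 1 - β.toReal⁻¹) (by linarith) (by linarith)
        (h _ (by linarith) (by linarith))
      have e1 : 1 / (1 + (1 - β.toReal⁻¹)) = α.toReal := by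
        rw [show 1 + (1 - β.toReal⁻¹) = α.toReal⁻¹ by linarith, one_div, inv_inv]
      have e2 : 1 / (1 - (1 - β.toReal⁻¹)) = β.toReal := by
        rw [sub_sub_cancel, one_div, inv_inv]
      rw [e1, e2] at key
      simpa only [renyiEntropy, hα1, hα, hβ1, hβt, if_false] using key

end Renyi

section Measurements

open Matrix
open scoped MatrixOrder Matrix.Norms.L2Operator

variable {N X Y : Type*} [Fintype N] [DecidableEq N] [Fintype X] [Fintype Y]

/-- Left multiplication by matrices, acting on vectorized matrices with the Hilbert–Schmidt norm. -/
noncomputable def leftMulHom (N : Type*) [Fintype N] [DecidableEq N] : Matrix N N ℂ →⋆ₐ[ℂ]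
    (EuclideanSpace ℂ (N × N) →L[ℂ] EuclideanSpace ℂ (N × N)) where
  toFun A := toEuclideanCLM (𝕜 := ℂ) ((1 : Matrix N N ℂ) ⊗ₖ A)
  map_one' := by simp
  map_mul' A B := by
    rw [← map_mul, ← mul_kronecker_mul, one_mul]
  map_zero' := by simp
  map_add' A B := by rw [kronecker_add, map_add]
  commutes' r := by
    rw [Algebra.algebraMap_eq_smul_one, kronecker_smul, map_smul, one_kronecker_one, map_one,
      Algebra.algebraMap_eq_smul_one]
  map_star' A := by
    rw [← map_star, star_eq_conjTranspose, star_eq_conjTranspose, conjTranspose_kronecker,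
      conjTranspose_one]

theorem leftMulHom_apply_vec (A S : Matrix N N ℂ) :
    leftMulHom N A (WithLp.toLp 2 (vec S)) = WithLp.toLp 2 (vec (A * S)) := by
  rw [vec_mul_eq_mulVec]
  rfl

theorem norm_toLp_vec_sq (S : Matrix N N ℂ) :
    ‖(WithLp.toLp 2 (vec S) : EuclideanSpace ℂ (N × N))‖ ^ 2 = (Sᴴ * S).trace.re := by
  rw [← star_vec_dotProduct_vec, EuclideanSpace.norm_sq_eq, dotProduct, Complex.re_sum]
  refine Finset.sum_congr rfl fun i _ => ?_
  simp [← Complex.normSq_eq_conj_mul_self, Complex.normSq_eq_norm_sq, -Complex.ofReal_pow]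

theorem norm_leftMulHom_le (A : Matrix N N ℂ) : ‖leftMulHom N A‖ ≤ ‖A‖ :=
  NonUnitalStarAlgHom.norm_apply_le (leftMulHom N) A

theorem isSelfAdjoint_leftMulHom_sqrt (A : Matrix N N ℂ) :
    IsSelfAdjoint (leftMulHom N (CFC.sqrt A)) :=
  (IsSelfAdjoint.of_nonneg (CFC.sqrt_nonneg A)).map (leftMulHom N)

theorem sum_leftMulHom_sqrt {E : X → Matrix N N ℂ} (hE : IsPOVM E) :
    ∑ x, leftMulHom N (CFC.sqrt (E x)) * leftMulHom N (CFC.sqrt (E x)) = 1 := by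
  simp_rw [← map_mul, fun x => CFC.sqrt_mul_sqrt_self (E x) (hE.posSemidef x).nonneg]
  rw [← map_sum, hE.sum_eq_one, map_one]

theorem norm_leftMulHom_sqrt_sq {A : Matrix N N ℂ} (hA : A.PosSemidef) (S : Matrix N N ℂ) :
    ‖leftMulHom N (CFC.sqrt A) (WithLp.toLp 2 (vec S))‖ ^ 2 = (A * (S * Sᴴ)).trace.re := by
  have h : (CFC.sqrt A)ᴴ = CFC.sqrt A := (CFC.sqrt_nonneg A).posSemidef.1
  rw [leftMulHom_apply_vec, norm_toLp_vec_sq, conjTranspose_mul, h, Matrix.mul_assoc,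
    ← Matrix.mul_assoc (CFC.sqrt A), CFC.sqrt_mul_sqrt_self A hA.nonneg, Matrix.trace_mul_comm,
    Matrix.mul_assoc]

theorem norm_sqrt_mul_sqrt_comm (A B : Matrix N N ℂ) :
    ‖CFC.sqrt A * CFC.sqrt B‖ = ‖CFC.sqrt B * CFC.sqrt A‖ := by
  rw [← norm_star, star_mul, (IsSelfAdjoint.of_nonneg (CFC.sqrt_nonneg A)).star_eq,
    (IsSelfAdjoint.of_nonneg (CFC.sqrt_nonneg B)).star_eq]

theorem povm_renyiEntropy_add_ge_of_one_le {E : X → Matrix N N ℂ} {F : Y → Matrix N N ℂ}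
    (hE : IsPOVM E) (hF : IsPOVM F) {ρ : Matrix N N ℂ} (hρ : IsState ρ) {c : ℝ}
    (hc : ∀ x y, ‖CFC.sqrt (E x) * CFC.sqrt (F y)‖ ≤ c)
    {α β : ℝ≥0∞} (hαβ : 1 / α + 1 / β = 2) (hβ : 1 ≤ β) :
    -2 * Real.log c ≤ renyiEntropy α (fun x => (E x * ρ).trace.re)
      + renyiEntropy β (fun y => (F y * ρ).trace.re) := by
  obtain ⟨S, hS⟩ : ∃ S : Matrix N N ℂ, ρ = S * Sᴴ := by
    refine ⟨CFC.sqrt ρ, ?_⟩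
    have h : (CFC.sqrt ρ)ᴴ = CFC.sqrt ρ := (CFC.sqrt_nonneg ρ).posSemidef.1
    rw [h, CFC.sqrt_mul_sqrt_self ρ hρ.posSemidef.nonneg]
  have hψ : ‖(WithLp.toLp 2 (vec S) : EuclideanSpace ℂ (N × N))‖ = 1 := by
    rw [← sq_eq_sq₀ (norm_nonneg _) zero_le_one, norm_toLp_vec_sq, Matrix.trace_mul_comm, ← hS,
      hρ.trace_eq_one]
    simp
  have hc' : ∀ x y, ‖leftMulHom N (CFC.sqrt (F y)) * leftMulHom N (CFC.sqrt (E x))‖ ≤ c := by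
    intro x y
    rw [← map_mul]
    refine (norm_leftMulHom_le _).trans ?_
    rw [norm_sqrt_mul_sqrt_comm]
    exact hc x y
  have key := fun t ht₀ ht₁ => log_sum_rpow_le_of_operators (t := t)
    (fun x => isSelfAdjoint_leftMulHom_sqrt (E x)) (sum_leftMulHom_sqrt hE)
    (fun y => isSelfAdjoint_leftMulHom_sqrt (F y)) (sum_leftMulHom_sqrt hF) hc' hψ ht₀ ht₁
  have hinf := norm_apply_sq_le_of_operators (sum_leftMulHom_sqrt hE) hc' (WithLp.toLp 2 (vec S))
  have hE₁ := sum_norm_apply_sq (fun x => isSelfAdjoint_leftMulHom_sqrt (E x))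
    (sum_leftMulHom_sqrt hE) (WithLp.toLp 2 (vec S))
  have hF₁ := sum_norm_apply_sq (fun y => isSelfAdjoint_leftMulHom_sqrt (F y))
    (sum_leftMulHom_sqrt hF) (WithLp.toLp 2 (vec S))
  rw [hψ, one_pow] at hE₁ hF₁
  simp_rw [hS, fun x => (norm_leftMulHom_sqrt_sq (hE.posSemidef x) S).symm,
    fun y => (norm_leftMulHom_sqrt_sq (hF.posSemidef y) S).symm]
  exact renyiEntropy_add_ge_of_one_le (key (1 / 2) (by norm_num) (by norm_num)).1
    (fun x => by positivity) (fun y => by positivity) hE₁ hF₁ (fun t ht₀ ht₁ => (key t ht₀ ht₁).2)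
    hinf hαβ hβ

/-- The Maassen–Uffink relation for two measurements of a mixed state. -/
theorem povm_renyiEntropy_add_ge {E : X → Matrix N N ℂ} {F : Y → Matrix N N ℂ}
    (hE : IsPOVM E) (hF : IsPOVM F) {ρ : Matrix N N ℂ} (hρ : IsState ρ) {c : ℝ}
    (hc : ∀ x y, ‖CFC.sqrt (E x) * CFC.sqrt (F y)‖ ≤ c)
    {α β : ℝ≥0∞} (hαβ : 1 / α + 1 / β = 2) :
    -2 * Real.log c ≤ renyiEntropy α (fun x => (E x * ρ).trace.re)
      + renyiEntropy β (fun y => (F y * ρ).trace.re) := by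
  rcases le_or_gt 1 β with hβ | hβ
  · exact povm_renyiEntropy_add_ge_of_one_le hE hF hρ hc hαβ hβ
  · have hα : 1 ≤ α := by
      by_contra! hα
      have h := ENNReal.add_lt_add (ENNReal.one_lt_inv.2 hα) (ENNReal.one_lt_inv.2 hβ)
      rw [← one_div, ← one_div, hαβ] at h
      norm_num at h
    rw [add_comm]
    rw [add_comm] at hαβ
    exact povm_renyiEntropy_add_ge_of_one_le hF hE hρ
      (fun y x => by rw [norm_sqrt_mul_sqrt_comm]; exact hc x y) hαβ hα

end Measurements

section Testers

open Matrix
open scoped MatrixOrder Matrix.Norms.L2Operator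

variable {n R A B X Y : Type*} [Fintype n] [DecidableEq n] [Fintype R] [DecidableEq R] [Fintype A]
  [DecidableEq A] [Fintype B] [DecidableEq B] [Fintype X] [Fintype Y]

theorem ProcessMU.IsState.one_sub_posSemidef {σ : Matrix n n ℂ} (hσ : IsState σ) :
    (1 - σ).PosSemidef := by
  rw [← Matrix.le_iff, ← map_one (algebraMap ℝ (Matrix n n ℂ))]
  have hsa : IsSelfAdjoint σ := hσ.posSemidef.1
  refine le_algebraMap_of_spectrum_le fun x hx => ?_
  rw [hσ.posSemidef.1.spectrum_real_eq_range_eigenvalues] at hx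
  obtain ⟨i, rfl⟩ := hx
  have h : ∑ j, hσ.posSemidef.1.eigenvalues j = 1 := by
    have := hσ.posSemidef.1.trace_eq_sum_eigenvalues
    rw [hσ.trace_eq_one] at this
    exact Complex.ofReal_injective (by rw [Complex.ofReal_sum, Complex.ofReal_one]; exact this.symm)
  exact h ▸ Finset.single_le_sum (fun j _ => hσ.posSemidef.eigenvalues_nonneg j)
    (Finset.mem_univ i)

theorem ProcessMU.Tester.effect_apply (T : Tester R A B X) (x : X) (a a' : A) (b b' : B) :
    T.effect x (a, b) (a', b') =
      ∑ r, ∑ r', T.state (r', a') (r, a) * T.povm x (r, b) (r', b') := by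
  change ((upsilon T.state (single a a' 1))ᴴ *
    Matrix.of fun r r' => T.povm x (r, b) (r', b')).trace = _
  simp only [Matrix.trace, Matrix.diag, Matrix.mul_apply]
  rw [Finset.sum_comm]
  refine Finset.sum_congr rfl fun r _ => Finset.sum_congr rfl fun r' _ => ?_
  have h : upsilon T.state (single a a' 1) r r' = T.state (r, a) (r', a') := by
    simp [upsilon, single_apply, ite_and]
  rw [conjTranspose_apply, h, T.isState.posSemidef.1.apply, of_apply]

theorem ProcessMU.Tester.effect_posSemidef (T : Tester R A B X) (x : X) :
    (T.effect x).PosSemidef := by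
  obtain ⟨C, hC⟩ : ∃ C : Matrix (R × A) (R × A) ℂ, T.state = C * Cᴴ := by
    refine ⟨CFC.sqrt T.state, ?_⟩
    have h : (CFC.sqrt T.state)ᴴ = CFC.sqrt T.state := (CFC.sqrt_nonneg T.state).posSemidef.1
    rw [h, CFC.sqrt_mul_sqrt_self T.state T.isState.posSemidef.nonneg]
  let W : R × A → Matrix (R × B) (A × B) ℂ :=
    fun k => of fun u v => if u.2 = v.2 then C (u.1, v.1) k else 0
  have h : T.effect x = ∑ k, (W k)ᴴ * T.povm x * W k := by
    ext ⟨a, b⟩ ⟨a', b'⟩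
    rw [T.effect_apply, Matrix.sum_apply, hC]
    have hk : ∀ k, ((W k)ᴴ * T.povm x * W k) (a, b) (a', b') =
        ∑ r, ∑ r', C (r', a') k * star (C (r, a) k) * T.povm x (r, b) (r', b') := by
      intro k
      simp only [Matrix.mul_apply, conjTranspose_apply, W, of_apply, Fintype.sum_prod_type,
        apply_ite star, star_zero, ite_mul, mul_ite, zero_mul, mul_zero, Finset.sum_ite_eq',
        Finset.mem_univ, if_true, Finset.sum_mul]
      rw [Finset.sum_comm]
      exact Finset.sum_congr rfl fun r _ => Finset.sum_congr rfl fun r' _ => by ring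
    simp_rw [hk, Matrix.mul_apply, conjTranspose_apply, Finset.sum_mul]
    rw [Finset.sum_comm (s := (Finset.univ : Finset (R × A)))]
    refine Finset.sum_congr rfl fun r _ => ?_
    rw [Finset.sum_comm]
  rw [h]
  exact posSemidef_sum _ fun k _ => (T.isPOVM.posSemidef x).conjTranspose_mul_mul_same (W k)

theorem ProcessMU.Tester.sum_effect (T : Tester R A B X) :
    ∑ x, T.effect x = T.reducedState.transpose ⊗ₖ (1 : Matrix B B ℂ) := by
  ext ⟨a, b⟩ ⟨a', b'⟩
  have h : ∀ r r', ∑ x, T.povm x (r, b) (r', b') = (1 : Matrix (R × B) (R × B) ℂ) (r, b) (r', b') :=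
    fun r r' => by rw [← T.isPOVM.sum_eq_one, Matrix.sum_apply]
  rw [Matrix.sum_apply]
  simp_rw [T.effect_apply]
  rw [Finset.sum_comm]
  simp_rw [Finset.sum_comm (s := (Finset.univ : Finset X)), ← Finset.mul_sum, h]
  by_cases hb : b = b' <;>
    simp [Matrix.one_apply, hb, Tester.reducedState]

theorem ProcessMU.Tester.isState_reducedState (T : Tester R A B X) : IsState T.reducedState := by
  refine ⟨?_, ?_⟩
  · have h : T.reducedState = ∑ r, T.state.submatrix (fun a => (r, a)) (fun a => (r, a)) := by
      ext a a'
      simp [Tester.reducedState, Matrix.sum_apply]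
    rw [h]
    exact posSemidef_sum _ fun r _ => T.isState.posSemidef.submatrix _
  · rw [← T.isState.trace_eq_one]
    simp only [Matrix.trace, Matrix.diag, Tester.reducedState, of_apply, Fintype.sum_prod_type]
    exact Finset.sum_comm

theorem ProcessMU.Tester.isPOVM_completedEffect (T : Tester R A B X) :
    IsPOVM T.completedEffect where
  posSemidef x := by
    cases x with
    | some x => exact T.effect_posSemidef x
    | none =>
      have h := T.isState_reducedState.one_sub_posSemidef.transpose.kronecker
        (PosSemidef.one (n := B) (R := ℂ))
      have h₁ : (1 : Matrix (A × B) (A × B) ℂ) - T.reducedState.transpose ⊗ₖ (1 : Matrix B B ℂ)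
          = (1 - T.reducedState)ᵀ ⊗ₖ (1 : Matrix B B ℂ) := by
        refine sub_eq_of_eq_add ?_
        rw [← add_kronecker, ← transpose_add, sub_add_cancel, transpose_one, one_kronecker_one]
      change (1 - T.reducedState.transpose ⊗ₖ (1 : Matrix B B ℂ)).PosSemidef
      rwa [h₁]
  sum_eq_one := by
    rw [Fintype.sum_option]
    change 1 - _ + ∑ x, T.effect x = 1
    rw [T.sum_effect, sub_add_cancel]

/-- The Choi operator of a superoperator. -/
noncomputable def choi (Ψ : Matrix A A ℂ →ₗ[ℂ] Matrix B B ℂ) : Matrix (A × B) (A × B) ℂ :=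
  idTensor A Ψ (maxEntangled A)

theorem ProcessMU.IsChannel.choi_posSemidef {Ψ : Matrix A A ℂ →ₗ[ℂ] Matrix B B ℂ}
    (hΨ : IsChannel Ψ) : (choi Ψ).PosSemidef := by
  have hφ : (maxEntangled A).PosSemidef := by
    have h : maxEntangled A =
        vecMulVec (fun u : A × A => if u.1 = u.2 then (1 : ℂ) else 0)
          (star fun u : A × A => if u.1 = u.2 then (1 : ℂ) else 0) := by
      ext u v
      by_cases hv : v.1 = v.2 <;> simp [maxEntangled, vecMulVec_apply, hv]
    rw [h]
    exact posSemidef_vecMulVec_self_star _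
  let e := Fintype.equivFin A
  have h := hΨ.completelyPositive (Fintype.card A) _
    (hφ.submatrix (fun u : Fin (Fintype.card A) × A => (e.symm u.1, u.2)))
  convert h.submatrix (fun u : A × B => (e u.1, u.2)) using 1
  ext u v
  simp [choi, idTensor]

theorem choi_apply (Ψ : Matrix A A ℂ →ₗ[ℂ] Matrix B B ℂ) (a a' : A) (b b' : B) :
    choi Ψ (a, b) (a', b') = Ψ (single a a' 1) b b' := by
  have h : (Matrix.of fun c c' => maxEntangled A (a, c) (a', c')) = single a a' 1 := by
    ext c c'
    by_cases ha : a = c <;> simp [maxEntangled, single_apply, ha]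
  change Ψ (Matrix.of fun c c' => maxEntangled A (a, c) (a', c')) b b' = _
  rw [h]

theorem apply_eq_sum_single (Ψ : Matrix A A ℂ →ₗ[ℂ] Matrix B B ℂ) (S : Matrix A A ℂ) :
    Ψ S = ∑ i, ∑ j, S i j • Ψ (single i j 1) := by
  conv_lhs => rw [matrix_eq_sum_single S]
  simp only [map_sum, ← map_smul, smul_single, smul_eq_mul, mul_one]

theorem ProcessMU.IsChannel.trace_choi {Ψ : Matrix A A ℂ →ₗ[ℂ] Matrix B B ℂ}
    (hΨ : IsChannel Ψ) : (choi Ψ).trace = Fintype.card A := by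
  have h : ∀ a, ∑ b, choi Ψ (a, b) (a, b) = 1 := by
    intro a
    simp_rw [choi_apply]
    exact (hΨ.tracePreserving (single a a 1)).trans (trace_single_eq_same a 1)
  simp [Matrix.trace, Fintype.sum_prod_type, h]

theorem ProcessMU.Tester.trace_effect_mul_choi (T : Tester R A B X)
    (Ψ : Matrix A A ℂ →ₗ[ℂ] Matrix B B ℂ) (x : X) :
    (T.effect x * choi Ψ).trace = (T.povm x * idTensor R Ψ T.state).trace := by
  have h : ∀ r b r' b', idTensor R Ψ T.state (r', b') (r, b) =
      ∑ a', ∑ a, T.state (r', a') (r, a) * choi Ψ (a', b') (a, b) := by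
    intro r b r' b'
    change Ψ (Matrix.of fun a a' => T.state (r', a) (r, a')) b' b = _
    rw [apply_eq_sum_single]
    simp [Matrix.sum_apply, choi_apply]
  have hl : (T.effect x * choi Ψ).trace = ∑ z : (A × A) × (B × B), ∑ w : R × R,
      T.povm x (w.1, z.2.1) (w.2, z.2.2) *
        (T.state (w.2, z.1.2) (w.1, z.1.1) * choi Ψ (z.1.2, z.2.2) (z.1.1, z.2.1)) := by
    simp only [Matrix.trace, Matrix.diag, Matrix.mul_apply, Fintype.sum_prod_type, T.effect_apply,
      Finset.sum_mul]
    refine Finset.sum_congr rfl fun a _ => ?_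
    rw [Finset.sum_comm]
    refine Finset.sum_congr rfl fun a' _ => Finset.sum_congr rfl fun b _ =>
      Finset.sum_congr rfl fun b' _ => Finset.sum_congr rfl fun r _ =>
      Finset.sum_congr rfl fun r' _ => by ring
  have hr : (T.povm x * idTensor R Ψ T.state).trace = ∑ w : R × R, ∑ z : (A × A) × (B × B),
      T.povm x (w.1, z.2.1) (w.2, z.2.2) *
        (T.state (w.2, z.1.2) (w.1, z.1.1) * choi Ψ (z.1.2, z.2.2) (z.1.1, z.2.1)) := by
    simp only [Matrix.trace, Matrix.diag, Matrix.mul_apply, h, Finset.mul_sum]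
    rw [Fintype.sum_prod_type, Fintype.sum_prod_type]
    refine Finset.sum_congr rfl fun r _ => ?_
    simp_rw [Fintype.sum_prod_type]
    rw [Finset.sum_comm]
    refine Finset.sum_congr rfl fun r' _ => ?_
    have := Finset.sum_comm (s := (Finset.univ : Finset (B × B)))
      (t := (Finset.univ : Finset (A × A)))
      (f := fun b a => T.povm x (r, b.1) (r', b.2) *
        (T.state (r', a.2) (r, a.1) * choi Ψ (a.2, b.2) (a.1, b.1)))
    simp only [Fintype.sum_prod_type] at this
    rw [← this]
    exact Finset.sum_congr rfl fun b _ => Finset.sum_congr rfl fun b' _ => Finset.sum_comm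
  rw [hl, hr, Finset.sum_comm]

theorem trace_kronecker_one_mul_choi {Ψ : Matrix A A ℂ →ₗ[ℂ] Matrix B B ℂ}
    (hΨ : IsChannel Ψ) (S : Matrix A A ℂ) :
    (S.transpose ⊗ₖ (1 : Matrix B B ℂ) * choi Ψ).trace = S.trace := by
  have h : ∀ a a', ∑ b, choi Ψ (a, b) (a', b) = if a = a' then 1 else 0 := by
    intro a a'
    simp_rw [choi_apply]
    refine (hΨ.tracePreserving (single a a' 1)).trans ?_
    split_ifs with ha
    · rw [ha, trace_single_eq_same]
    · exact trace_single_eq_of_ne _ _ _ ha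
  simp only [Matrix.trace, Matrix.diag, Matrix.mul_apply, Fintype.sum_prod_type, kronecker_apply,
    Matrix.one_apply, mul_ite, mul_one, mul_zero, ite_mul, zero_mul, Finset.sum_ite_eq,
    Finset.mem_univ, if_true, transpose_apply]
  refine Finset.sum_congr rfl fun a _ => ?_
  rw [Finset.sum_comm]
  simp [← Finset.mul_sum, h]

theorem ProcessMU.Tester.nonempty (T : Tester R A B X) : Nonempty A := by
  by_contra h
  rw [not_nonempty_iff] at h
  have := T.isState.trace_eq_one
  simp [Matrix.trace] at this

theorem ProcessMU.Tester.trace_completedEffect (T : Tester R A B X)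
    {Ψ : Matrix A A ℂ →ₗ[ℂ] Matrix B B ℂ} (hΨ : IsChannel Ψ) :
    (fun x => (T.completedEffect x * ((Fintype.card A : ℂ)⁻¹ • choi Ψ)).trace.re)
      = paddedVector (Fintype.card A) (T.prob Ψ) := by
  have := T.nonempty
  have hd : (Fintype.card A : ℝ) ≠ 0 := by exact_mod_cast Fintype.card_ne_zero
  have hcast : ((Fintype.card A : ℂ))⁻¹ = (((Fintype.card A : ℝ)⁻¹ : ℝ) : ℂ) := by push_cast; rfl
  funext x
  rw [Matrix.mul_smul, Matrix.trace_smul, smul_eq_mul, hcast, Complex.re_ofReal_mul]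
  cases x with
  | some x =>
    change _ * (T.effect x * _).trace.re = 1 / _ * T.prob Ψ x
    rw [T.trace_effect_mul_choi, one_div]
    rfl
  | none =>
    change _ * ((1 - _ : Matrix (A × B) (A × B) ℂ) * _).trace.re = _ / _
    rw [sub_mul, one_mul, trace_sub, hΨ.trace_choi, trace_kronecker_one_mul_choi hΨ,
      T.isState_reducedState.trace_eq_one]
    simp
    ring

theorem ProcessMU.IsChannel.isState_choi [Nonempty A] {Ψ : Matrix A A ℂ →ₗ[ℂ] Matrix B B ℂ}
    (hΨ : IsChannel Ψ) : IsState ((Fintype.card A : ℂ)⁻¹ • choi Ψ) where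
  posSemidef := hΨ.choi_posSemidef.smul (by positivity)
  trace_eq_one := by
    rw [Matrix.trace_smul, hΨ.trace_choi, smul_eq_mul, inv_mul_cancel₀]
    exact_mod_cast Fintype.card_ne_zero

end Testers

theorem theorem1 {R A B X Y : Type*} [Fintype R] [DecidableEq R] [Fintype A] [DecidableEq A]
    [Fintype B] [DecidableEq B] [Fintype X] [Fintype Y]
    (Ψ : Matrix A A ℂ →ₗ[ℂ] Matrix B B ℂ) (hΨ : IsChannel Ψ)
    (T₁ : Tester R A B X) (T₂ : Tester R A B Y)
    (α β : ℝ≥0∞) (hαβ : 1 / α + 1 / β = 2) :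
    renyiEntropy α (paddedVector (Fintype.card A) (T₁.prob Ψ))
      + renyiEntropy β (paddedVector (Fintype.card A) (T₂.prob Ψ))
      ≥ -2 * Real.log (maxOverlap T₁ T₂) := by
  have := T₁.nonempty
  rw [← T₁.trace_completedEffect hΨ, ← T₂.trace_completedEffect hΨ]
  refine povm_renyiEntropy_add_ge T₁.isPOVM_completedEffect T₂.isPOVM_completedEffect
    hΨ.isState_choi (fun x y => ?_) hαβ
  exact Finset.le_sup' (fun z : Option X × Option Y => overlap T₁ T₂ z.1 z.2)
    (Finset.mem_univ (x, y))
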